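/- A continuous probability measure on the unit circle $\mathbb T$ is a Borel probability measure giving mass $0$ to every single point. A bounded operator $T$ on a separable infinite-dimensional complex Hilbert space $H$ is said to have perfectly spanning unimodular eigenvectors if there is a continuous probability measure $\sigma$ on $\mathbb T=\{\lambda\in\mathbb C:|\lambda|=1\}$ such that for every Borel set $B\subseteq\mathbb T$ with $\sigma(B)=1$, the closed linear span of $\bigcup_{\lambda\in B}\ker(T-\lambda I)$ is $H$. Theorem. Let $(n_k)_{k\ge 0}$ be a strictly increasing sequence of positive integers with $n_0=1$ such that for every $\varepsilon>0$ there exists $\lambda\in\mathbb T\setminus\{1\}$ with $\sup_{k\ge 0}|\lambda^{n_k}-1|\le\varepsilon$. Then for every $\delta>0$ there exists a bounded linear operator $T$ on the complex Hilbert space $\ell_2(\mathbb N)$ such that $T$ has perfectly spanning unimodular eigenvectors and $\sup_{k\ge 0}\|T^{n_k}\|\le 1+\delta$. In particular, the unimodular point spectrum of $T$, that is, the set of eigenvalues of $T$ of modulus $1$, is uncountable. -/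

import Mathlib

open MeasureTheory

/-- The Borel σ-algebra of the unit circle. -/
noncomputable instance circleMeasurableSpace : MeasurableSpace Circle := borel Circle

instance circleBorelSpace : BorelSpace Circle := ⟨rfl⟩

/-- The unimodular point spectrum of `T`: the set of eigenvalues of `T` of modulus `1`. -/
def unimodularPointSpectrum {H : Type*} [NormedAddCommGroup H] [InnerProductSpace ℂ H]
    (T : H →L[ℂ] H) : Set ℂ :=
  {z | ‖z‖ = 1 ∧ Module.End.HasEigenvalue (T : H →ₗ[ℂ] H) z}

/-- `T` has perfectly spanning unimodular eigenvectors: there is a continuous (atomless) Borel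
probability measure `σ` on the unit circle such that for every Borel subset `B` of the circle with
`σ B = 1`, the closed linear span of the eigenspaces `ker (T - z I)`, `z ∈ B`, is the whole
space. -/
def HasPerfectlySpanningUnimodularEigenvectors {H : Type*} [NormedAddCommGroup H]
    [InnerProductSpace ℂ H] (T : H →L[ℂ] H) : Prop :=
  ∃ σ : Measure Circle, IsProbabilityMeasure σ ∧ (∀ z : Circle, σ {z} = 0) ∧
    ∀ B : Set Circle, MeasurableSet B → σ B = 1 →
      (Submodule.span ℂ (⋃ z ∈ B,
        (Module.End.eigenspace (T : H →ₗ[ℂ] H) (z : ℂ) : Set H))).topologicalClosure = ⊤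

/-! Index an orthonormal basis by finite sets `S` of naturals, and for `x` in the Cantor space put
`k_x = ∑_S (∏_{j ∈ S} x_j 2⁻ʲ) e_S`. These vectors depend continuously on `x` and span a dense
subspace (`span_range_cantorVector`), and bounded operators `P_j` satisfy `P_j k_x = x_j k_x`
(`exists_digit_operator`). Hence `T = ∏_j (1 + (z_j - 1) P_j)` has each `k_x` as eigenvector, with
eigenvalue `φ(x) = ∏_j z_j^{x_j}`.

Powers only replace `z_j` by `z_j ^ m` (`digitProduct_pow`), so `‖T ^ n k‖ ≤ exp (∑_j |z_j ^ n k -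
1| ‖P_j‖)`. The hypothesis allows `z_j` to be chosen, after the `P_j`, so that this is at most `1 +
δ`, and so that `|z_j - 1|` decays fast enough to make `φ` injective
(`eq_of_tendsto_selectedProduct`). The image under `φ` of the coin-tossing measure is then the
required `σ`. -/

/-- Weighted composition operators with bounded weight and injective symbol act on `ℓ²`. -/
theorem exists_lp_weighted_comp {ι : Type*} (c : ι → ℂ) (C : ℝ) (hc : ∀ i, ‖c i‖ ≤ C)
    (s : ι → ι) (hs : Function.Injective s) :
    ∃ W : lp (fun _ : ι => ℂ) 2 →L[ℂ] lp (fun _ : ι => ℂ) 2, ∀ f i, W f i = c i * f (s i) := by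
  have h2 : (0 : ℝ) < (2 : ENNReal).toReal := by norm_num
  have hle : ∀ f : lp (fun _ : ι => ℂ) 2, ∀ i,
      ‖c i * f (s i)‖ ^ (2 : ENNReal).toReal ≤
        (|C|) ^ (2 : ENNReal).toReal * ‖f (s i)‖ ^ (2 : ENNReal).toReal := by
    intro f i
    rw [norm_mul, Real.mul_rpow (norm_nonneg _) (norm_nonneg _)]
    gcongr
    exact (hc i).trans (le_abs_self C)
  have hsum : ∀ f : lp (fun _ : ι => ℂ) 2,
      Summable fun i => ‖f (s i)‖ ^ (2 : ENNReal).toReal := fun f =>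
    ((lp.memℓp f).summable h2).comp_injective hs
  have hmem : ∀ f : lp (fun _ : ι => ℂ) 2, Memℓp (fun i => c i * f (s i)) 2 := fun f =>
    memℓp_gen (((hsum f).mul_left _).of_nonneg_of_le (fun i => by positivity) (hle f))
  let L : lp (fun _ : ι => ℂ) 2 →ₗ[ℂ] lp (fun _ : ι => ℂ) 2 :=
    { toFun := fun f => ⟨fun i => c i * f (s i), hmem f⟩
      map_add' := fun f g => by
        ext i
        exact mul_add _ _ _
      map_smul' := fun r f => by
        ext i
        simp [mul_left_comm] }
  refine ⟨L.mkContinuous |C| fun f => ?_, fun f i => rfl⟩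
  refine lp.norm_le_of_tsum_le h2 (by positivity) ?_
  rw [Real.mul_rpow (abs_nonneg _) (norm_nonneg _), lp.norm_rpow_eq_tsum h2 f]
  have hcomp : Summable fun i => ‖f i‖ ^ (2 : ENNReal).toReal := (lp.memℓp f).summable h2
  calc ∑' i, ‖c i * f (s i)‖ ^ (2 : ENNReal).toReal
      ≤ ∑' i, (|C|) ^ (2 : ENNReal).toReal * ‖f (s i)‖ ^ (2 : ENNReal).toReal :=
        Summable.tsum_le_tsum (hle f) ((hmem f).summable h2) ((hsum f).mul_left _)
    _ = (|C|) ^ (2 : ENNReal).toReal * ∑' i, ‖f (s i)‖ ^ (2 : ENNReal).toReal := tsum_mul_left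
    _ ≤ _ := by
        refine mul_le_mul_of_nonneg_left ?_ (by positivity)
        exact tsum_comp_le_tsum_of_inj hcomp (fun i => by positivity) hs

/-! ### A spanning family of vectors over the Cantor space -/

/-- The product weight attached to a finite set `S` and a point `x` of the Cantor space. -/
noncomputable def cantorWeight (x : ℕ → Bool) (S : Finset ℕ) : ℂ :=
  ∏ j ∈ S, if x j then (1 / 2 : ℂ) ^ j else 0

theorem norm_cantorWeight_le (x : ℕ → Bool) (S : Finset ℕ) :
    ‖cantorWeight x S‖ ≤ ∏ j ∈ S, (1 / 2 : ℝ) ^ j := by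
  rw [cantorWeight, norm_prod]
  refine Finset.prod_le_prod (fun j _ => norm_nonneg _) fun j _ => ?_
  split_ifs <;> simp

/-- The sum expands `∏_j (1 + 2⁻ʲ)`, which is finite. It dominates the series of `cantorVector`
uniformly in `x`, whence continuity. -/
theorem summable_prod_half_pow : Summable fun S : Finset ℕ => ∏ j ∈ S, (1 / 2 : ℝ) ^ j :=
  summable_finsetProd_of_summable_nonneg (fun j => by positivity)
    (summable_geometric_of_lt_one (by norm_num) (by norm_num))

theorem continuous_cantorWeight (S : Finset ℕ) : Continuous fun x => cantorWeight x S := by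
  refine continuous_finsetProd _ fun j _ => ?_
  exact (continuous_of_discreteTopology (f := fun b : Bool => if b then (1 / 2 : ℂ) ^ j else 0)).comp
    (continuous_apply j)

theorem cantorWeight_insert {x : ℕ → Bool} {S : Finset ℕ} {j : ℕ} (hj : j ∉ S) :
    cantorWeight x (insert j S) = (if x j then (1 / 2 : ℂ) ^ j else 0) * cantorWeight x S :=
  Finset.prod_insert hj

theorem cantorWeight_eq_zero {x : ℕ → Bool} {S : Finset ℕ} {j : ℕ} (hj : j ∈ S) (hx : x j = false) :
    cantorWeight x S = 0 :=
  Finset.prod_eq_zero hj (by simp [hx])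

/-- The vector of `ℓ²` attached to a point of the Cantor space; the coordinates of `ℓ²` are indexed
by the finite sets of natural numbers through `e`. -/
noncomputable def cantorVector (e : ℕ ≃ Finset ℕ) (x : ℕ → Bool) : lp (fun _ : ℕ => ℂ) 2 :=
  ∑' S : Finset ℕ, cantorWeight x S • lp.single 2 (e.symm S) (1 : ℂ)

theorem norm_cantorWeight_smul_single_le (e : ℕ ≃ Finset ℕ) (S : Finset ℕ) (x : ℕ → Bool) :
    ‖cantorWeight x S • (lp.single 2 (e.symm S) (1 : ℂ) : lp (fun _ : ℕ => ℂ) 2)‖ ≤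
      ∏ j ∈ S, (1 / 2 : ℝ) ^ j := by
  rw [norm_smul, lp.norm_single (by norm_num), norm_one, mul_one]
  exact norm_cantorWeight_le x S

theorem continuous_cantorVector (e : ℕ ≃ Finset ℕ) : Continuous (cantorVector e) :=
  continuous_tsum (fun S => (continuous_cantorWeight S).smul continuous_const)
    summable_prod_half_pow (norm_cantorWeight_smul_single_le e)

theorem cantorVector_apply (e : ℕ ≃ Finset ℕ) (x : ℕ → Bool) (i : ℕ) :
    cantorVector e x i = cantorWeight x (e i) := by
  have hs : Summable fun S : Finset ℕ =>
      cantorWeight x S • (lp.single 2 (e.symm S) (1 : ℂ) : lp (fun _ : ℕ => ℂ) 2) :=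
    .of_norm_bounded summable_prod_half_pow fun S => norm_cantorWeight_smul_single_le e S x
  have h := (lp.evalCLM ℂ (fun _ : ℕ => ℂ) 2 i).map_tsum hs
  change cantorVector e x i = ∑' S, (cantorWeight x S • (lp.single 2 (e.symm S) (1 : ℂ) :
    lp (fun _ : ℕ => ℂ) 2)) i at h
  rw [h, tsum_eq_single (e i)]
  · simp
  · intro S hS
    have : i ≠ e.symm S := fun h => hS (by simp [h])
    simp [Pi.single_eq_of_ne this]

/-- For `x` the indicator of `S`, the vector is a finite combination of the `e_U` with `U ⊆ S`, with
nonzero coefficient at `S`. Induction on `S` is thus a triangular elimination that recovers every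
basis vector. -/
theorem span_range_cantorVector (e : ℕ ≃ Finset ℕ) :
    (Submodule.span ℂ (Set.range (cantorVector e))).topologicalClosure = ⊤ := by
  set V := Submodule.span ℂ (Set.range (cantorVector e))
  have hsingle : ∀ S : Finset ℕ, (lp.single 2 (e.symm S) (1 : ℂ) : lp (fun _ : ℕ => ℂ) 2) ∈ V := by
    intro S
    induction S using Finset.strongInduction with
    | H S ih =>
      have hk : cantorVector e (fun j => decide (j ∈ S)) ∈ V := Submodule.subset_span ⟨_, rfl⟩
      have hsum : cantorVector e (fun j => decide (j ∈ S)) =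
          ∑ U ∈ S.powerset, cantorWeight (fun j => decide (j ∈ S)) U •
            lp.single 2 (e.symm U) (1 : ℂ) := by
        refine tsum_eq_sum fun U hU => ?_
        rw [Finset.mem_powerset, Finset.not_subset] at hU
        obtain ⟨j, hjU, hjS⟩ := hU
        rw [cantorWeight_eq_zero hjU (by simpa using hjS), zero_smul]
      rw [hsum, ← Finset.insert_erase (Finset.mem_powerset_self S),
        Finset.sum_insert (Finset.notMem_erase _ _)] at hk
      have hrest : ∑ U ∈ S.powerset.erase S, cantorWeight (fun j => decide (j ∈ S)) U •
          (lp.single 2 (e.symm U) (1 : ℂ) : lp (fun _ : ℕ => ℂ) 2) ∈ V := by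
        refine Submodule.sum_mem _ fun U hU => Submodule.smul_mem _ _ (ih U ?_)
        rw [Finset.mem_erase, Finset.mem_powerset] at hU
        exact hU.2.ssubset_of_ne hU.1
      have hmain := (Submodule.add_mem_iff_left _ hrest).1 hk
      refine (Submodule.smul_mem_iff _ ?_).1 hmain
      refine Finset.prod_ne_zero_iff.2 fun j hj => ?_
      simp [hj]
  rw [Submodule.eq_top_iff']
  intro f
  refine mem_closure_of_tendsto (lp.hasSum_single (by norm_num) f) (.of_forall fun s => ?_)
  refine Submodule.sum_mem _ fun i _ => ?_
  have : (lp.single 2 i (f i) : lp (fun _ : ℕ => ℂ) 2) =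
      f i • lp.single 2 (e.symm (e i)) (1 : ℂ) := by
    rw [← lp.single_smul]
    simp
  rw [this]
  exact Submodule.smul_mem _ _ (hsingle _)

/-- If `j ∈ S`, the coefficient of `e_S` already contains the factor `x_j`. If `j ∉ S`, then `x_j`
times it is `2 ^ j` times the coefficient at `insert j S`. -/
theorem exists_digit_operator (e : ℕ ≃ Finset ℕ) (j : ℕ) :
    ∃ P : lp (fun _ : ℕ => ℂ) 2 →L[ℂ] lp (fun _ : ℕ => ℂ) 2, ∀ x,
      P (cantorVector e x) = (if x j then (1 : ℂ) else 0) • cantorVector e x := by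
  obtain ⟨W₁, h₁⟩ := exists_lp_weighted_comp (fun i => if j ∈ e i then (1 : ℂ) else 0) 1
    (fun i => by split_ifs <;> simp) id Function.injective_id
  -- Toggling `j` agrees with insertion where the weight is nonzero and, unlike insertion, is
  -- injective on all finite sets.
  obtain ⟨W₂, h₂⟩ := exists_lp_weighted_comp (fun i => if j ∈ e i then (0 : ℂ) else 2 ^ j) (2 ^ j)
    (fun i => by split_ifs <;> simp) (fun i => e.symm (symmDiff (e i) {j}))
    (e.symm.injective.comp ((symmDiff_left_injective ({j} : Finset ℕ)).comp e.injective))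
  refine ⟨W₁ + W₂, fun x => ?_⟩
  ext i
  rw [add_apply, lp.coeFn_add, Pi.add_apply, h₁, h₂, lp.coeFn_smul,
    Pi.smul_apply, smul_eq_mul, cantorVector_apply, cantorVector_apply, id, cantorVector_apply,
    e.apply_symm_apply]
  by_cases hj : j ∈ e i
  · cases hx : x j
    · simp [hj, cantorWeight_eq_zero hj hx]
    · simp [hj]
  · have : symmDiff (e i) {j} = insert j (e i) := by
      ext l
      simp only [Finset.mem_symmDiff, Finset.mem_singleton, Finset.mem_insert]
      grind
    rw [this, cantorWeight_insert hj]
    cases hx : x j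
    · simp [hj]
    · simp [hj]

/-! ### Products of digit operators -/

section

variable {E : Type*} [NormedAddCommGroup E] [NormedSpace ℂ E]

/-- The ordered product of the operators `1 + (w j - 1) P j` for `j < N`. -/
noncomputable def digitProduct (P : ℕ → E →L[ℂ] E) (w : ℕ → ℂ) : ℕ → E →L[ℂ] E
  | 0 => 1
  | N + 1 => digitProduct P w N * (1 + (w N - 1) • P N)

theorem digitProduct_apply {P : ℕ → E →L[ℂ] E} {x : ℕ → Bool} {v : E}
    (hv : ∀ j, P j v = (if x j then (1 : ℂ) else 0) • v) (w : ℕ → ℂ) (N : ℕ) :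
    digitProduct P w N v = (∏ j ∈ Finset.range N, if x j then w j else 1) • v := by
  induction N with
  | zero => simp [digitProduct]
  | succ N ih =>
    have : (1 + (w N - 1) • P N) v = (if x N then w N else 1) • v := by
      rw [add_apply, one_apply_eq_self, smul_apply, hv]
      split_ifs
      · module
      · simp
    rw [digitProduct, mul_apply_eq_comp, this, map_smul, ih, Finset.prod_range_succ,
      smul_smul, mul_comm]

theorem norm_digitProduct_le [Nontrivial E] (P : ℕ → E →L[ℂ] E) (w : ℕ → ℂ) (N : ℕ) :
    ‖digitProduct P w N‖ ≤ Real.exp (∑ j ∈ Finset.range N, ‖w j - 1‖ * ‖P j‖) := by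
  induction N with
  | zero => simp [digitProduct]
  | succ N ih =>
    rw [digitProduct, Finset.sum_range_succ, Real.exp_add]
    refine (norm_mul_le _ _).trans (mul_le_mul ih ?_ (norm_nonneg _) (Real.exp_nonneg _))
    calc ‖1 + (w N - 1) • P N‖ ≤ ‖(1 : E →L[ℂ] E)‖ + ‖(w N - 1) • P N‖ := norm_add_le _ _
      _ = ‖w N - 1‖ * ‖P N‖ + 1 := by rw [norm_one, norm_smul, add_comm]
      _ ≤ _ := Real.add_one_le_exp _

theorem exists_tendsto_digitProduct [Nontrivial E] [CompleteSpace E] (P : ℕ → E →L[ℂ] E)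
    (w : ℕ → ℂ) (hw : Summable fun j => ‖w j - 1‖ * ‖P j‖) :
    ∃ T, Filter.Tendsto (digitProduct P w) Filter.atTop (nhds T) := by
  refine cauchySeq_tendsto_of_complete (cauchySeq_of_summable_dist
    (.of_nonneg_of_le (fun _ => dist_nonneg) (fun N => ?_)
      (hw.mul_left (Real.exp (∑' j, ‖w j - 1‖ * ‖P j‖)))))
  rw [dist_eq_norm', digitProduct, mul_add, mul_one, add_sub_cancel_left]
  refine (norm_mul_le _ _).trans ?_
  rw [norm_smul]
  gcongr
  refine (norm_digitProduct_le P w N).trans (Real.exp_le_exp.2 ?_)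
  exact hw.sum_le_tsum _ fun j _ => by positivity

theorem ContinuousLinearMap.ext_of_span_range {X : Type*} {v : X → E}
    (hspan : (Submodule.span ℂ (Set.range v)).topologicalClosure = ⊤) {A B : E →L[ℂ] E}
    (h : ∀ x, A (v x) = B (v x)) : A = B :=
  ContinuousLinearMap.ext_on ((Submodule.dense_iff_topologicalClosure_eq_top).2 hspan)
    (by rintro _ ⟨x, rfl⟩; exact h x)

theorem pow_apply_of_apply_eq_smul {A : E →L[ℂ] E} {v : E} {c : ℂ} (h : A v = c • v) (m : ℕ) :
    (A ^ m) v = c ^ m • v := by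
  induction m with
  | zero => simp
  | succ m ih => rw [pow_succ, mul_apply_eq_comp, h, map_smul, ih, smul_smul, pow_succ']

/-- Both sides have the same eigenvalue on each `v x`, because the selector of each factor is `0` or
`1`; density of the span then forces equality. -/
theorem digitProduct_pow {P : ℕ → E →L[ℂ] E} {v : (ℕ → Bool) → E}
    (hspan : (Submodule.span ℂ (Set.range v)).topologicalClosure = ⊤)
    (hv : ∀ j x, P j (v x) = (if x j then (1 : ℂ) else 0) • v x) (w : ℕ → ℂ) (N m : ℕ) :
    digitProduct P w N ^ m = digitProduct P (fun j => w j ^ m) N := by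
  refine ContinuousLinearMap.ext_of_span_range hspan fun x => ?_
  rw [pow_apply_of_apply_eq_smul (digitProduct_apply (fun j => hv j x) w N),
    digitProduct_apply (fun j => hv j x), ← Finset.prod_pow]
  congr 1
  refine Finset.prod_congr rfl fun j _ => ?_
  split_ifs <;> simp

end

/-! ### Separated infinite products on the circle -/

/-- A rapidly converging sequence of nontrivial points of the circle whose powers along `n` are
uniformly close to `1`. -/
theorem exists_rapid_sequence {n : ℕ → ℕ}
    (hJ : ∀ ε : ℝ, 0 < ε → ∃ z : Circle, z ≠ 1 ∧ ∀ k : ℕ, ‖(z : ℂ) ^ n k - 1‖ ≤ ε)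
    (hn0 : n 0 = 1) (ε : ℕ → ℝ) (hε : ∀ j, 0 < ε j) :
    ∃ z : ℕ → Circle, (∀ j, z j ≠ 1) ∧ (∀ j k, ‖(z j : ℂ) ^ n k - 1‖ ≤ ε j) ∧
      ∀ j, ‖(z (j + 1) : ℂ) - 1‖ ≤ ‖(z j : ℂ) - 1‖ / 4 := by
  choose f hf1 hf using hJ
  have hpos : ∀ z : Circle, z ≠ 1 → 0 < ‖(z : ℂ) - 1‖ / 4 := fun z hz => by
    have : (z : ℂ) ≠ 1 := fun h => hz (Circle.ext (by simpa using h))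
    have := norm_pos_iff.2 (sub_ne_zero.2 this)
    positivity
  let g : ℕ → {z : Circle // z ≠ 1} := fun j => Nat.rec ⟨f (ε 0) (hε 0), hf1 _ _⟩
    (fun j z => ⟨f (min (ε (j + 1)) (‖(z.1 : ℂ) - 1‖ / 4)) (lt_min (hε _) (hpos _ z.2)), hf1 _ _⟩) j
  refine ⟨fun j => (g j).1, fun j => (g j).2, fun j k => ?_, fun j => ?_⟩
  · cases j with
    | zero => exact hf _ _ k
    | succ j => exact (hf _ _ k).trans (min_le_left _ _)
  -- Since `n 0 = 1`, the bound at `k = 0` controls the distance from the point itself to `1`.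
  · have := (hf (min (ε (j + 1)) (‖((g j).1 : ℂ) - 1‖ / 4))
      (lt_min (hε _) (hpos _ (g j).2)) 0).trans (min_le_right _ _)
    rwa [hn0, pow_one] at this

/-- The partial products of `z` selected by the binary sequence `x`. -/
noncomputable def selectedProduct (z : ℕ → Circle) (x : ℕ → Bool) (N : ℕ) : ℂ :=
  ∏ j ∈ Finset.range N, if x j then (z j : ℂ) else 1

theorem norm_selectedProduct (z : ℕ → Circle) (x : ℕ → Bool) (N : ℕ) :
    ‖selectedProduct z x N‖ = 1 := by
  rw [selectedProduct, norm_prod]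
  refine Finset.prod_eq_one fun j _ => ?_
  split_ifs
  · exact Circle.norm_coe _
  · exact norm_one

theorem norm_selectedProduct_succ_sub_le (z : ℕ → Circle) (x : ℕ → Bool) (N : ℕ) :
    ‖selectedProduct z x (N + 1) - selectedProduct z x N‖ ≤ ‖(z N : ℂ) - 1‖ := by
  have : selectedProduct z x (N + 1) - selectedProduct z x N =
      selectedProduct z x N * ((if x N then (z N : ℂ) else 1) - 1) := by
    rw [selectedProduct, Finset.prod_range_succ, ← selectedProduct]
    ring
  rw [this, norm_mul, norm_selectedProduct, one_mul]
  split_ifs <;> simp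

/-- The steps after index `j` are dominated by a geometric series of ratio `1/4`, and `∑_{i ≥ 1} 4⁻ⁱ
= 1/3`. -/
theorem norm_selectedProduct_sub_le {z : ℕ → Circle}
    (hz : ∀ j, ‖(z (j + 1) : ℂ) - 1‖ ≤ ‖(z j : ℂ) - 1‖ / 4) (x : ℕ → Bool) (j m : ℕ) :
    ‖selectedProduct z x (j + 1 + m) - selectedProduct z x (j + 1)‖ ≤ ‖(z j : ℂ) - 1‖ / 3 := by
  have hgeom : ∀ m, ‖(z (j + m) : ℂ) - 1‖ ≤ ‖(z j : ℂ) - 1‖ * (1 / 4) ^ m := by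
    intro m
    induction m with
    | zero => simp
    | succ m ih =>
      have := hz (j + m)
      rw [← add_assoc, pow_succ]
      linarith
  have key : ‖selectedProduct z x (j + 1 + m) - selectedProduct z x (j + 1)‖ ≤
      ‖(z j : ℂ) - 1‖ * (1 - (1 / 4) ^ m) / 3 := by
    induction m with
    | zero => simp
    | succ m ih =>
      have h1 := norm_selectedProduct_succ_sub_le z x (j + 1 + m)
      have h2 := hgeom (1 + m)
      have h3 := norm_sub_le_norm_sub_add_norm_sub (selectedProduct z x (j + 1 + m + 1))
        (selectedProduct z x (j + 1 + m)) (selectedProduct z x (j + 1))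
      rw [← add_assoc, pow_add, pow_one] at h2
      rw [← add_assoc, pow_succ]
      linarith
  refine key.trans ?_
  have : 0 ≤ ‖(z j : ℂ) - 1‖ * (1 / 4) ^ m := by positivity
  linarith

/-- At the first differing digit `j` the partial products separate by exactly `|z_j - 1|`. Each tail
recovers at most a third of that gap, so the limits would stay at least a third of it apart. -/
theorem eq_of_tendsto_selectedProduct {z : ℕ → Circle} (hz1 : ∀ j, z j ≠ 1)
    (hz : ∀ j, ‖(z (j + 1) : ℂ) - 1‖ ≤ ‖(z j : ℂ) - 1‖ / 4) {x y : ℕ → Bool} {a : ℂ}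
    (hx : Filter.Tendsto (selectedProduct z x) Filter.atTop (nhds a))
    (hy : Filter.Tendsto (selectedProduct z y) Filter.atTop (nhds a)) : x = y := by
  by_contra hxy
  have hex : ∃ j, x j ≠ y j := Function.ne_iff.1 hxy
  classical
  set j := Nat.find hex
  have hj : x j ≠ y j := Nat.find_spec hex
  have hlt : ∀ i < j, x i = y i := fun i hi => not_not.1 (Nat.find_min hex hi)
  have hpre : selectedProduct z x j = selectedProduct z y j := by
    refine Finset.prod_congr rfl fun i hi => ?_
    rw [hlt i (Finset.mem_range.1 hi)]
  have hdiff : ‖selectedProduct z x (j + 1) - selectedProduct z y (j + 1)‖ = ‖(z j : ℂ) - 1‖ := by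
    rw [selectedProduct, Finset.prod_range_succ, ← selectedProduct, hpre, selectedProduct,
      selectedProduct, Finset.prod_range_succ, ← mul_sub, ← selectedProduct, norm_mul,
      norm_selectedProduct, one_mul]
    cases hxj : x j <;> cases hyj : y j <;> simp_all [norm_sub_rev]
  have hpos : 0 < ‖(z j : ℂ) - 1‖ :=
    norm_pos_iff.2 (sub_ne_zero.2 fun h => hz1 j (Circle.ext (by simpa using h)))
  have hlim : Filter.Tendsto
      (fun m => ‖selectedProduct z x (m + (j + 1)) - selectedProduct z y (m + (j + 1))‖)
      Filter.atTop (nhds 0) := by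
    have := ((Filter.tendsto_add_atTop_iff_nat (j + 1)).2 hx).sub
      ((Filter.tendsto_add_atTop_iff_nat (j + 1)).2 hy)
    simpa using this.norm
  have hge : ‖(z j : ℂ) - 1‖ / 3 ≤ 0 := by
    refine ge_of_tendsto' hlim fun m => ?_
    rw [add_comm m]
    have h1 := norm_selectedProduct_sub_le hz x j m
    have h2 := norm_selectedProduct_sub_le hz y j m
    have h3 := norm_sub_le_norm_sub_add_norm_sub (selectedProduct z x (j + 1))
      (selectedProduct z x (j + 1 + m)) (selectedProduct z y (j + 1))
    have h4 := norm_sub_le_norm_sub_add_norm_sub (selectedProduct z x (j + 1 + m))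
      (selectedProduct z y (j + 1 + m)) (selectedProduct z y (j + 1))
    rw [norm_sub_rev] at h1
    linarith
  linarith

/-! ### From an eigenvector field to perfect spanning -/

/-- The Cantor space carries a probability measure which is positive on nonempty open sets and
vanishes on singletons. -/
theorem exists_measure_cantor : ∃ μ : Measure (ℕ → Bool), IsProbabilityMeasure μ ∧
    (∀ U : Set (ℕ → Bool), IsOpen U → U.Nonempty → μ U ≠ 0) ∧ ∀ x, μ {x} = 0 := by
  let ν : Measure Bool := (PMF.uniformOfFintype Bool).toMeasure
  have hν : ∀ b, ν {b} = 2⁻¹ := fun b => by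
    simp [ν]
  have hcyl : ∀ (x : ℕ → Bool) (s : Finset ℕ),
      Measure.infinitePi (fun _ => ν) (Set.pi s fun j => {x j}) = 2⁻¹ ^ s.card := fun x s => by
    rw [Measure.infinitePi_pi _ (fun _ _ => .singleton _)]
    simp [hν]
  refine ⟨Measure.infinitePi fun _ => ν, inferInstance, ?_, fun x => ?_⟩
  · rintro U hU ⟨x, hx⟩ h0
    obtain ⟨s, u, hu, hsub⟩ := isOpen_pi_iff.1 hU x hx
    have : Measure.infinitePi (fun _ => ν) (Set.pi (s : Set ℕ) fun j => {x j}) = 0 := by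
      refine measure_mono_null (fun y hy => hsub fun j hj => ?_) h0
      rw [show y j = x j from hy j hj]
      exact (hu j hj).2
    rw [hcyl] at this
    simp at this
  · refine le_antisymm (ge_of_tendsto' (ENNReal.tendsto_pow_atTop_nhds_zero_of_lt_one
      (r := 2⁻¹) (by simp)) fun N => ?_) zero_le
    have := hcyl x (Finset.range N)
    rw [Finset.card_range] at this
    rw [← this]
    refine measure_mono ?_
    rintro y rfl j _
    rfl

/-- A continuous injective field of eigenvectors over the Cantor space which spans a dense subspace
yields perfectly spanning unimodular eigenvectors. -/
theorem hasPerfectlySpanning_of_eigenvector_field {H : Type*} [NormedAddCommGroup H]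
    [InnerProductSpace ℂ H] {T : H →L[ℂ] H} {v : (ℕ → Bool) → H} (hv : Continuous v)
    (hspan : (Submodule.span ℂ (Set.range v)).topologicalClosure = ⊤) {φ : (ℕ → Bool) → Circle}
    (hφ : Continuous φ) (hφi : Function.Injective φ) (hT : ∀ x, T (v x) = (φ x : ℂ) • v x) :
    HasPerfectlySpanningUnimodularEigenvectors T := by
  obtain ⟨μ, hμ, hopen, hpoint⟩ := exists_measure_cantor
  have hmeas : Measurable φ := hφ.measurable
  refine ⟨μ.map φ, Measure.isProbabilityMeasure_map hmeas.aemeasurable, fun z => ?_,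
    fun B hB hB1 => ?_⟩
  · rw [Measure.map_apply hmeas (measurableSet_singleton z)]
    by_cases hz : ∃ x, φ x = z
    · obtain ⟨x, rfl⟩ := hz
      rw [← Set.image_singleton, hφi.preimage_image]
      exact hpoint x
    · rw [Set.preimage_singleton_eq_empty.2 fun ⟨x, hx⟩ => hz ⟨x, hx⟩, measure_empty]
  · rw [Measure.map_apply hmeas hB] at hB1
    -- Nonempty open sets have positive measure, so each meets a set of full measure; continuity of
    -- `v` then recovers all `v x` from a dense set of `x`.
    have hdense : Dense (φ ⁻¹' B) := by
      rw [dense_iff_inter_open]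
      intro U hU hne
      by_contra hempty
      rw [Set.not_nonempty_iff_eq_empty] at hempty
      refine hopen U hU hne (measure_mono_null (t := (φ ⁻¹' B)ᶜ) (fun x hx hxB => ?_)
        ((prob_compl_eq_zero_iff (hmeas hB)).2 hB1))
      exact Set.notMem_empty x (hempty ▸ ⟨hx, hxB⟩)
    rw [eq_top_iff, ← hspan]
    refine Submodule.topologicalClosure_minimal _ (Submodule.span_le.2 ?_)
      (Submodule.isClosed_topologicalClosure _)
    rintro _ ⟨x, rfl⟩
    refine map_mem_closure hv (hdense x) fun y hy => Submodule.subset_span ?_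
    exact Set.mem_biUnion hy (Module.End.mem_eigenspace_iff.2 (hT y))

theorem not_countable_unimodularPointSpectrum {H : Type*} [NormedAddCommGroup H]
    [InnerProductSpace ℂ H] {T : H →L[ℂ] H} {v : (ℕ → Bool) → H} (hv : ∀ x, v x ≠ 0)
    {φ : (ℕ → Bool) → Circle} (hφi : Function.Injective φ)
    (hT : ∀ x, T (v x) = (φ x : ℂ) • v x) : ¬ (unimodularPointSpectrum T).Countable := by
  intro hc
  have hmaps : Set.MapsTo (fun x => (φ x : ℂ)) Set.univ (unimodularPointSpectrum T) := fun x _ =>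
    ⟨Circle.norm_coe _, Module.End.hasEigenvalue_of_hasEigenvector
      ⟨Module.End.mem_eigenspace_iff.2 (hT x), hv x⟩⟩
  have := Set.MapsTo.countable_of_injOn hmaps
    (Circle.coe_injective.comp hφi).injOn hc
  have hcount : Countable (ℕ → Bool) := Set.countable_univ_iff.1 this
  have hle : Cardinal.mk (ℕ → Bool) ≤ Cardinal.aleph0 := Cardinal.mk_le_aleph0_iff.2 hcount
  simp only [Cardinal.mk_pi, Cardinal.mk_bool, Cardinal.prod_const, Cardinal.mk_nat,
    Cardinal.lift_aleph0, Cardinal.lift_ofNat] at hle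
  exact (Cardinal.cantor Cardinal.aleph0).not_ge hle

/-! ### Construction of the operator -/

theorem theorem2p1 (n : ℕ → ℕ) (hn : StrictMono n) (hn0 : n 0 = 1)
    (hJ : ∀ ε : ℝ, 0 < ε → ∃ z : Circle, z ≠ 1 ∧ ∀ k : ℕ, ‖(z : ℂ) ^ n k - 1‖ ≤ ε)
    (δ : ℝ) (hδ : 0 < δ) :
    ∃ T : lp (fun _ : ℕ => ℂ) 2 →L[ℂ] lp (fun _ : ℕ => ℂ) 2,
      HasPerfectlySpanningUnimodularEigenvectors T ∧
      (∀ k : ℕ, ‖T ^ n k‖ ≤ 1 + δ) ∧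
      ¬ (unimodularPointSpectrum T).Countable := by
  let e : ℕ ≃ Finset ℕ := (Denumerable.eqv (Finset ℕ)).symm
  -- The coordinate at `∅` equals `1` on every `cantorVector e x`, so evaluating there reads off
  -- eigenvalues.
  let o : ℕ := e.symm ∅
  have hvo : ∀ x, cantorVector e x o = 1 := fun x => by
    rw [cantorVector_apply, e.apply_symm_apply, cantorWeight, Finset.prod_empty]
  have hv0 : ∀ x, cantorVector e x ≠ 0 := fun x h => by simpa [h] using hvo x
  have : Nontrivial (lp (fun _ : ℕ => ℂ) 2) := ⟨_, _, hv0 fun _ => false⟩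
  have hspan := span_range_cantorVector e
  choose P hP using exists_digit_operator e
  set η : ℝ := Real.log (1 + δ)
  have hη : 0 < η := Real.log_pos (by linarith)
  -- The tolerances absorb `‖P j‖`, the `1 +` keeping the denominator positive; the remaining `η / 2
  -- / 2 ^ j` sum to `η`, and `exp η = 1 + δ`.
  obtain ⟨z, hz1, hzn, hz⟩ := exists_rapid_sequence hJ hn0
    (fun j => η / 2 / 2 ^ j / (1 + ‖P j‖)) (fun j => by positivity)
  have hterm : ∀ k j, ‖(z j : ℂ) ^ n k - 1‖ * ‖P j‖ ≤ η / 2 / 2 ^ j := fun k j => by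
    have h1 : 0 < 1 + ‖P j‖ := by positivity
    have h2 := (le_div_iff₀ h1).1 (hzn j k)
    nlinarith [norm_nonneg ((z j : ℂ) ^ n k - 1)]
  have hgeom : HasSum (fun j : ℕ => η / 2 / 2 ^ j) η := hasSum_geometric_two' η
  have hnorm : ∀ k N, ‖digitProduct P (fun j => (z j : ℂ)) N ^ n k‖ ≤ 1 + δ := fun k N => by
    rw [digitProduct_pow hspan hP, ← Real.exp_log (show (0 : ℝ) < 1 + δ by linarith)]
    refine (norm_digitProduct_le _ _ _).trans (Real.exp_le_exp.2 ?_)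
    exact (Finset.sum_le_sum fun j _ => hterm k j).trans
      (sum_le_hasSum _ (fun j _ => by positivity) hgeom)
  obtain ⟨T, hT⟩ := exists_tendsto_digitProduct P (fun j => (z j : ℂ))
    (.of_nonneg_of_le (fun j => by positivity)
      (fun j => by simpa only [hn0, pow_one] using hterm 0 j) hgeom.summable)
  have happ : ∀ x, Filter.Tendsto (fun N => selectedProduct z x N • cantorVector e x) Filter.atTop
      (nhds (T (cantorVector e x))) := fun x => by
    have := ((ContinuousLinearMap.apply ℂ _ (cantorVector e x)).continuous.tendsto T).comp hT
    refine this.congr fun N => ?_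
    exact digitProduct_apply (fun j => hP j x) _ N
  let L := lp.evalCLM ℂ (fun _ : ℕ => ℂ) 2 o
  have hL : ∀ x, L (cantorVector e x) = 1 := hvo
  have hsel : ∀ x, Filter.Tendsto (selectedProduct z x) Filter.atTop
      (nhds (L (T (cantorVector e x)))) := fun x => by
    refine ((L.continuous.tendsto _).comp (happ x)).congr fun N => ?_
    rw [Function.comp_apply, map_smul, hL, smul_eq_mul, mul_one]
  have heig : ∀ x, T (cantorVector e x) = L (T (cantorVector e x)) • cantorVector e x := fun x =>
    tendsto_nhds_unique (happ x) ((hsel x).smul_const _)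
  have hunit : ∀ x, ‖L (T (cantorVector e x))‖ = 1 := fun x =>
    tendsto_nhds_unique (hsel x).norm (by simp [norm_selectedProduct])
  let φ : (ℕ → Bool) → Circle := fun x =>
    ⟨L (T (cantorVector e x)), mem_sphere_zero_iff_norm.2 (hunit x)⟩
  -- Continuity of the eigenvalue comes from that of `T` and of the vectors, with no separate study
  -- of the infinite product.
  have hφ : Continuous φ :=
    (L.continuous.comp (T.continuous.comp (continuous_cantorVector e))).subtype_mk _
  have hφi : Function.Injective φ := fun x y hxy => by
    have h : L (T (cantorVector e x)) = L (T (cantorVector e y)) := congrArg Subtype.val hxy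
    exact eq_of_tendsto_selectedProduct hz1 hz (hsel x) (h ▸ hsel y)
  refine ⟨T, hasPerfectlySpanning_of_eigenvector_field (continuous_cantorVector e) hspan hφ hφi heig,
    fun k => ?_, not_countable_unimodularPointSpectrum hv0 hφi heig⟩
  exact le_of_tendsto' (hT.pow (n k)).norm (hnorm k)
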